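/- Let $A\in\mathbb{R}^{n\times n}$ and $B\in\mathbb{R}^{m\times m}$ be symmetric positive definite, with smallest and largest eigenvalues $\lambda_{\min}(A),\lambda_{\max}(A)$ and $\lambda_{\min}(B),\lambda_{\max}(B)$, and let $b_1\in\mathbb{R}^n$, $b_2\in\mathbb{R}^m$ have Euclidean norm $1$. Let $k\ge 0$ be an integer, let $K_k(A,b_1)=\mathrm{span}\{b_1,Ab_1,\dots,A^{k-1}b_1\}$ and $K_k(B,b_2)=\mathrm{span}\{b_2,Bb_2,\dots,B^{k-1}b_2\}$, and let $V_k$ and $W_k$ be real matrices with orthonormal columns such that $\mathrm{range}(V_k)=K_k(A,b_1)$ and $\mathrm{range}(W_k)=K_k(B,b_2)$. Then the Sylvester equation $AX+XB=b_1b_2^T$ has a unique solution $X\in\mathbb{R}^{n\times m}$; there is a unique matrix $Y_k$ for which the approximation $X_k=V_kY_kW_k^T$ satisfies the Galerkin condition $$V_k^T\left(AX_k+X_kB-b_1b_2^T\right)W_k=0;$$ and $$\|X-X_k\|_\star\le\frac{2}{\lambda_{\min}(A)+\lambda_{\min}(B)}\left(\frac{\sqrt{\hat\kappa_A}+1}{\sqrt{\hat\kappa_A}}\left(\frac{\sqrt{\hat\kappa_A}-1}{\sqrt{\hat\kappa_A}+1}\right)^k+\frac{\sqrt{\hat\kappa_B}+1}{\sqrt{\hat\kappa_B}}\left(\frac{\sqrt{\hat\kappa_B}-1}{\sqrt{\hat\kappa_B}+1}\right)^k\right),$$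 where $\|\cdot\|_\star$ is either the matrix $2$-norm (the operator norm induced by the Euclidean vector norm) or the Frobenius norm, and $$\hat\kappa_A=\frac{\lambda_{\max}(A)+\lambda_{\min}(B)}{\lambda_{\min}(A)+\lambda_{\min}(B)},\qquad \hat\kappa_B=\frac{\lambda_{\max}(B)+\lambda_{\min}(A)}{\lambda_{\min}(B)+\lambda_{\min}(A)}$$ are the condition numbers of $A+\lambda_{\min}(B)I$ and $B+\lambda_{\min}(A)I$. Here $0^0=1$. -/

import Mathlib

open Matrix

noncomputable section

namespace SylvesterGalerkin

/-- Smallest eigenvalue of a real symmetric matrix of positive size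
(its spectrum is then a finite nonempty set of reals). -/
def lambdaMin {n : ℕ} (A : Matrix (Fin n) (Fin n) ℝ) : ℝ := sInf (spectrum ℝ A)

/-- Largest eigenvalue of a real symmetric matrix of positive size. -/
def lambdaMax {n : ℕ} (A : Matrix (Fin n) (Fin n) ℝ) : ℝ := sSup (spectrum ℝ A)

/-- The number `(λ_max(A) + λ_min(B)) / (λ_min(A) + λ_min(B))`, the spectral condition number of the
shifted matrix `A + λ_min(B) I`. -/
def kappaHat {n m : ℕ} (A : Matrix (Fin n) (Fin n) ℝ) (B : Matrix (Fin m) (Fin m) ℝ) : ℝ :=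
  (lambdaMax A + lambdaMin B) / (lambdaMin A + lambdaMin B)

/-- The Krylov space `K_k(A, b) = span {b, A b, …, A ^ (k - 1) b}`. -/
def krylov {n : ℕ} (A : Matrix (Fin n) (Fin n) ℝ) (b : Fin n → ℝ) (k : ℕ) :
    Submodule ℝ (Fin n → ℝ) :=
  Submodule.span ℝ (Set.range fun i : Fin k => (A ^ (i : ℕ)) *ᵥ b)

/-- `V` has orthonormal columns and its column space is `K`. -/
def IsOrthonormalBasisMatrix {n p : ℕ} (V : Matrix (Fin n) (Fin p) ℝ)
    (K : Submodule ℝ (Fin n → ℝ)) : Prop :=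
  Vᵀ * V = 1 ∧ LinearMap.range V.mulVecLin = K

/-- The residual `A X + X B - b₁ b₂ᵀ` of the Sylvester equation at `X`. -/
def residual {n m : ℕ} (A : Matrix (Fin n) (Fin n) ℝ) (B : Matrix (Fin m) (Fin m) ℝ)
    (b₁ : Fin n → ℝ) (b₂ : Fin m → ℝ) (X : Matrix (Fin n) (Fin m) ℝ) :
    Matrix (Fin n) (Fin m) ℝ :=
  A * X + X * B - vecMulVec b₁ b₂

/-- `X` solves the Sylvester equation `A X + X B = b₁ b₂ᵀ`. -/
def IsSolution {n m : ℕ} (A : Matrix (Fin n) (Fin n) ℝ) (B : Matrix (Fin m) (Fin m) ℝ)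
    (b₁ : Fin n → ℝ) (b₂ : Fin m → ℝ) (X : Matrix (Fin n) (Fin m) ℝ) : Prop :=
  A * X + X * B = vecMulVec b₁ b₂

/-- The Galerkin condition on `Y`: with `R` the residual at `V Y Wᵀ`, it says `Vᵀ R W = 0`. -/
def IsGalerkin {n m p q : ℕ} (A : Matrix (Fin n) (Fin n) ℝ) (B : Matrix (Fin m) (Fin m) ℝ)
    (b₁ : Fin n → ℝ) (b₂ : Fin m → ℝ) (V : Matrix (Fin n) (Fin p) ℝ)
    (W : Matrix (Fin m) (Fin q) ℝ) (Y : Matrix (Fin p) (Fin q) ℝ) : Prop :=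
  Vᵀ * residual A B b₁ b₂ (V * Y * Wᵀ) * W = 0

open scoped Matrix.Norms.L2Operator in
/-- The matrix 2-norm, i.e. the operator norm induced by the Euclidean vector norms. -/
def norm2 {n m : ℕ} (M : Matrix (Fin n) (Fin m) ℝ) : ℝ := ‖M‖

open scoped Matrix.Norms.Frobenius in
/-- The Frobenius norm. -/
def normF {n m : ℕ} (M : Matrix (Fin n) (Fin m) ℝ) : ℝ := ‖M‖

/-- The term `((√κ + 1) / √κ) ((√κ - 1) / (√κ + 1)) ^ k`. -/
def cgTerm (κ : ℝ) (k : ℕ) : ℝ :=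
  (√κ + 1) / √κ * ((√κ - 1) / (√κ + 1)) ^ k

/-- The right-hand side of the error bound. -/
def errorBound {n m : ℕ} (A : Matrix (Fin n) (Fin n) ℝ) (B : Matrix (Fin m) (Fin m) ℝ)
    (k : ℕ) : ℝ :=
  2 / (lambdaMin A + lambdaMin B) * (cgTerm (kappaHat A B) k + cgTerm (kappaHat B A) k)

end SylvesterGalerkin

end

/-! Insert the half-projected solution `Z` of `T Z + Z B = (Vᵀ b₁) b₂ᵀ`, where `T = Vᵀ A V`. The
error splits into `X - V Z`, which projects only on the left, and `V (Z - Y Wᵀ)`, whose transpose is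
the same kind of error for `B`, with `T` in place of `A`. `T` inherits the form bounds of `A`, so
`normF_oneSided_error_le` covers both.

For one side, an eigenvector `u` of the other coefficient with eigenvalue `μ` turns the equation
into the system `(A + μ) X u = (u ⬝ d) b`, with `V Z u` its Galerkin solution. By
`mulVec_aeval_compress`, polynomials of degree below `k` are reproduced exactly, so the column error
is at most twice the error of approximating `(x + μ)⁻¹` by such a polynomial on `[α, β]`.
`exists_polynomial_approx_inv` bounds that error through Chebyshev polynomials, and
`inv_mul_cgTerm_antitone` shows that the smallest shift is the worst. Summing squares over an
eigenbasis gives the Frobenius bound, which dominates the 2-norm. -/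

namespace SylvesterGalerkin

/-! ### Polynomial approximation of the inverse -/

section Polynomials

open Polynomial

/-- At the point `-(ρ + ρ⁻¹) / 2` the combination `T_{k+1} + ρ T_k` is a single power of `ρ`. -/
theorem eval_chebyshev_T_add (ρ : ℝ) (hρ : ρ ≠ 0) (k : ℕ) :
    (Chebyshev.T ℝ (k + 1 : ℕ)).eval (-(ρ + ρ⁻¹) / 2) +
      ρ * (Chebyshev.T ℝ (k : ℕ)).eval (-(ρ + ρ⁻¹) / 2) =
      (-ρ⁻¹) ^ (k + 1) * ((1 - ρ ^ 2) / 2) := by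
  -- Here `T_k = ((-ρ)^k + (-ρ)^(-k)) / 2`, and the combination cancels the mode `(-ρ)^k`.
  induction k with
  | zero =>
    simp
    field_simp
    ring
  | succ k ih =>
    have h := Chebyshev.T_add_two ℝ (k : ℤ)
    have h' : (Chebyshev.T ℝ (k + 1 + 1 : ℕ)).eval (-(ρ + ρ⁻¹) / 2) =
        2 * (-(ρ + ρ⁻¹) / 2) * (Chebyshev.T ℝ (k + 1 : ℕ)).eval (-(ρ + ρ⁻¹) / 2) -
          (Chebyshev.T ℝ (k : ℕ)).eval (-(ρ + ρ⁻¹) / 2) := by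
      have e : ((k + 1 + 1 : ℕ) : ℤ) = (k : ℤ) + 2 := by push_cast; ring
      rw [e, h]
      simp
    rw [h', pow_succ]
    linear_combination (-ρ⁻¹) * ih +
      (Chebyshev.T ℝ (k : ℕ)).eval (-(ρ + ρ⁻¹) / 2) * mul_inv_cancel₀ hρ

/-- On `[-1, 1]` one has `(T_{k+1} + ρ T_k)² ≤ 1 + 2 ρ z + ρ²`. -/
theorem eval_chebyshev_T_add_sq_le (ρ : ℝ) (k : ℕ) {z : ℝ} (hz : z ∈ Set.Icc (-1 : ℝ) 1) :
    ((Chebyshev.T ℝ (k + 1 : ℕ)).eval z + ρ * (Chebyshev.T ℝ (k : ℕ)).eval z) ^ 2 ≤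
      1 + 2 * ρ * z + ρ ^ 2 := by
  obtain ⟨θ, rfl⟩ : ∃ θ, Real.cos θ = z := ⟨Real.arccos z, Real.cos_arccos hz.1 hz.2⟩
  rw [Chebyshev.T_real_cos, Chebyshev.T_real_cos]
  set a := (((k + 1 : ℕ) : ℤ) : ℝ) * θ with ha
  set b := (((k : ℕ) : ℤ) : ℝ) * θ with hb
  have hθ : θ = a - b := by rw [ha, hb]; push_cast; ring
  rw [hθ, Real.cos_sub]
  -- The right side is `|exp(ia) + ρ exp(ib)|²`, the left side the square of the real part.
  nlinarith [Real.sin_sq_add_cos_sq a, Real.sin_sq_add_cos_sq b,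
    sq_nonneg (Real.sin a + ρ * Real.sin b)]

/-- Uniform polynomial approximation of `x ↦ (x + μ)⁻¹` on `[α, β]`. -/
theorem exists_polynomial_approx_inv {α β μ : ℝ} (hαμ : 0 < α + μ) (hαβ : α ≤ β) (k : ℕ) :
    ∃ P : ℝ[X], P.degree < k ∧ ∀ x ∈ Set.Icc α β,
      |(x + μ)⁻¹ - P.eval x| ≤ (α + μ)⁻¹ * cgTerm ((β + μ) / (α + μ)) k := by
  set κ := (β + μ) / (α + μ) with hκ
  have hκ1 : 1 ≤ κ := by rw [hκ, one_le_div hαμ]; linarith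
  have hs1 : 1 ≤ √κ := Real.one_le_sqrt.mpr hκ1
  -- Degree below `0` forces `P = 0`; afterwards `k + 1` plays the role of the original `k`.
  rcases k with _ | k
  · refine ⟨0, by simp, fun x hx => ?_⟩
    have hx0 : 0 < x + μ := by linarith [hx.1]
    rw [eval_zero, sub_zero, abs_of_pos (inv_pos.mpr hx0), cgTerm, pow_zero, mul_one]
    have h1 : (x + μ)⁻¹ ≤ (α + μ)⁻¹ := inv_anti₀ hαμ (by linarith [hx.1])
    have h2 : 1 ≤ (√κ + 1) / √κ := by rw [one_le_div (by linarith)]; linarith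
    nlinarith [inv_pos.mpr hαμ]
  -- A one-point interval gives `κ = 1` and bound zero, met by a constant; `ℓ` below needs `α < β`.
  rcases hαβ.eq_or_lt with rfl | hlt
  · refine ⟨C (α + μ)⁻¹, lt_of_le_of_lt degree_C_le (by exact_mod_cast Nat.succ_pos k),
      fun x hx => ?_⟩
    obtain rfl : x = α := le_antisymm hx.2 hx.1
    have : κ = 1 := by rw [hκ, div_self hαμ.ne']
    simp [cgTerm, this]
  set s := √κ with hs
  have hκs : s ^ 2 = κ := Real.sq_sqrt (by linarith)
  have hκ1' : 1 < κ := by rw [hκ, one_lt_div hαμ]; linarith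
  have hs1' : 1 < s := by nlinarith
  set ρ := (s - 1) / (s + 1) with hρ
  have hs0 : 0 < s + 1 := by linarith
  have hρ0 : 0 < ρ := div_pos (by linarith) hs0
  have hρ1 : ρ < 1 := by rw [hρ, div_lt_one hs0]; linarith
  have hβ : β + μ = s ^ 2 * (α + μ) := by rw [hκs, hκ]; field_simp
  -- the affine map from `[α, β]` to `[-1, 1]`, the Chebyshev combination, and the residual
  set ℓ : ℝ[X] := C (2 / (β - α)) * X - C ((β + α) / (β - α)) with hℓ
  set Q : ℝ[X] := (Chebyshev.T ℝ (k + 1 : ℕ) + C ρ * Chebyshev.T ℝ (k : ℕ)).comp ℓ with hQ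
  -- Normalized so that `c Q(-μ) = 1`: then `X + μ` divides `1 - c Q`, and the quotient is the
  -- approximant.
  set c : ℝ := (-ρ) ^ (k + 1) * (2 / (1 - ρ ^ 2)) with hc
  have hba : 0 < β - α := by linarith
  have hρ2 : 0 < 1 - ρ ^ 2 := by nlinarith
  have hℓeval (x : ℝ) : ℓ.eval x = (2 * x - β - α) / (β - α) := by
    simp [hℓ]; field_simp; ring
  have hℓμ : ℓ.eval (-μ) = -(ρ + ρ⁻¹) / 2 := by
    rw [hℓeval, hρ, inv_div]
    have h1 : s - 1 ≠ 0 := by linarith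
    have h2 : β - α = (s - 1) * (s + 1) * (α + μ) := by linear_combination hβ
    have h3 : 2 * -μ - β - α = -((s ^ 2 + 1) * (α + μ)) := by linear_combination -hβ
    rw [h2, h3]
    field_simp
    ring
  have hQμ : c * Q.eval (-μ) = 1 := by
    rw [hQ, eval_comp, hℓμ, eval_add, eval_mul, eval_C, eval_chebyshev_T_add ρ hρ0.ne', hc]
    have : (-ρ) ^ (k + 1) * (-ρ⁻¹) ^ (k + 1) = 1 := by
      rw [← mul_pow, neg_mul_neg, mul_inv_cancel₀ hρ0.ne', one_pow]
    calc _ = (-ρ) ^ (k + 1) * (-ρ⁻¹) ^ (k + 1) * ((2 / (1 - ρ ^ 2)) * ((1 - ρ ^ 2) / 2)) := by ring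
      _ = 1 := by rw [this]; field_simp
  have hℓdeg : ℓ.natDegree ≤ 1 := by rw [hℓ]; compute_degree
  have hQdeg : Q.natDegree ≤ k + 1 := by
    rw [hQ]
    refine natDegree_comp_le.trans ?_
    have : (Chebyshev.T ℝ (k + 1 : ℕ) + C ρ * Chebyshev.T ℝ (k : ℕ)).natDegree ≤ k + 1 := by
      refine natDegree_add_le_of_degree_le ?_ ((natDegree_C_mul_le _ _).trans ?_)
      · rw [Chebyshev.natDegree_T, Int.natAbs_natCast]
      · rw [Chebyshev.natDegree_T, Int.natAbs_natCast]; exact k.le_succ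
    nlinarith
  set q : ℝ[X] := 1 - C c * Q with hq
  have hroot : q.IsRoot (-μ) := by simp [IsRoot, hq, hQμ]
  have hdvd : (X - C (-μ)) * (q /ₘ (X - C (-μ))) = q := mul_divByMonic_eq_iff_isRoot.mpr hroot
  refine ⟨q /ₘ (X - C (-μ)), ?_, fun x hx => ?_⟩
  · refine lt_of_le_of_lt degree_le_natDegree ?_
    rw [natDegree_divByMonic _ (monic_X_sub_C _), natDegree_X_sub_C]
    have : q.natDegree ≤ k + 1 := by
      rw [hq]
      exact (natDegree_sub_le_of_le (natDegree_one.trans_le (Nat.zero_le (k + 1)))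
        ((natDegree_C_mul_le _ _).trans hQdeg)).trans (max_self _).le
    exact_mod_cast (by omega : q.natDegree - 1 < k + 1)
  have hx0 : 0 < x + μ := by linarith [hx.1]
  have hev := congrArg (eval x) hdvd
  have hqx : q.eval x = 1 - c * Q.eval x := by simp [hq]
  rw [eval_mul, hqx] at hev
  simp only [eval_sub, eval_X, eval_C, sub_neg_eq_add] at hev
  have herr : (x + μ)⁻¹ - (q /ₘ (X - C (-μ))).eval x = c * Q.eval x / (x + μ) := by
    field_simp
    linarith
  rw [herr, abs_div, abs_mul, abs_of_pos hx0]
  set z := ℓ.eval x with hz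
  have hzI : z ∈ Set.Icc (-1 : ℝ) 1 := by
    rw [hz, hℓeval, Set.mem_Icc, le_div_iff₀ hba, div_le_iff₀ hba]
    constructor <;> linarith [hx.1, hx.2]
  have hQx : (Q.eval x) ^ 2 ≤ 1 + 2 * ρ * z + ρ ^ 2 := by
    have := eval_chebyshev_T_add_sq_le ρ k hzI
    rwa [hQ, eval_comp, eval_add, eval_mul, eval_C]
  set D := 1 + 2 * ρ * z + ρ ^ 2 with hD
  have hDlow : (1 - ρ) ^ 2 ≤ D := by rw [hD]; nlinarith [hzI.1]
  -- The choice of `ρ` makes `x + μ` proportional to `D`, so `D` cancels once `|Q| ≤ √D ≤ D / (1 -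
  -- ρ)`.
  have hxD : x + μ = (β - α) / (4 * ρ) * D := by
    have h2 : β - α = (s - 1) * (s + 1) * (α + μ) := by linear_combination hβ
    have h3 : (β - α) * z = 2 * (x + μ) - (s ^ 2 + 1) * (α + μ) := by
      rw [hz, hℓeval, mul_div_cancel₀ _ hba.ne']
      linear_combination -hβ
    have h4 : (β - α) / (4 * ρ) * D = (β - α) * (1 + ρ ^ 2) / (4 * ρ) + (β - α) * z / 2 := by
      rw [hD]; field_simp; ring
    rw [h4, h3, h2, hρ]
    have h1 : s - 1 ≠ 0 := by linarith
    field_simp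
    ring
  have hD0 : 0 < D := lt_of_lt_of_le (by nlinarith) hDlow
  have hQD : |Q.eval x| ≤ D / (1 - ρ) := by
    rw [le_div_iff₀ (by linarith)]
    refine abs_le_of_sq_le_sq' ?_ hD0.le |>.2
    rw [mul_pow, sq_abs]
    nlinarith [sq_nonneg (1 - ρ)]
  have hcabs : |c| = ρ ^ (k + 1) * (2 / (1 - ρ ^ 2)) := by
    rw [hc, abs_mul, abs_pow, abs_neg, abs_of_pos hρ0, abs_of_pos (by positivity)]
  have hfin : |c| * |Q.eval x| / (x + μ) ≤
      ρ ^ (k + 1) * (2 / (1 - ρ ^ 2)) * (D / (1 - ρ)) / ((β - α) / (4 * ρ) * D) := by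
    rw [hcabs, ← hxD]
    gcongr
  refine hfin.trans_eq ?_
  have h1ρ : 1 - ρ = 2 / (s + 1) := by rw [hρ]; field_simp; ring
  have h1ρ' : 1 - ρ ^ 2 = 4 * s / (s + 1) ^ 2 := by rw [hρ]; field_simp; ring
  have h2 : β - α = (s - 1) * (s + 1) * (α + μ) := by linear_combination hβ
  rw [cgTerm, ← hs, ← hρ, h1ρ, h1ρ', h2]
  have h1 : s - 1 ≠ 0 := by linarith
  have hρs : ρ * (s + 1) = s - 1 := by rw [hρ]; field_simp
  have hs00 : s ≠ 0 := by linarith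
  rw [← hρs]
  field_simp

/-- The approximation bound for the shift `μ` decreases in `μ`. -/
theorem inv_mul_cgTerm_antitone {α β ν μ : ℝ} (hα : 0 < α + ν) (hαβ : α ≤ β) (hνμ : ν ≤ μ)
    (k : ℕ) :
    (α + μ)⁻¹ * cgTerm ((β + μ) / (α + μ)) k ≤ (α + ν)⁻¹ * cgTerm ((β + ν) / (α + ν)) k := by
  have hα' : 0 < α + μ := by linarith
  set κ := (β + ν) / (α + ν) with hκ
  set κ' := (β + μ) / (α + μ) with hκ'
  have h1 : 1 ≤ κ' := by rw [hκ', one_le_div hα']; linarith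
  have hle : κ' ≤ κ := by
    rw [hκ, hκ', div_le_div_iff₀ hα' hα]
    nlinarith
  have hs1 : 1 ≤ √κ' := Real.one_le_sqrt.mpr h1
  have hsle : √κ' ≤ √κ := Real.sqrt_le_sqrt hle
  -- `(α + μ) √κ' = √((α + μ)(β + μ))` increases with the shift; by `hfac` the prefactor is a sum of
  -- two decreasing reciprocals.
  have hprod : (α + ν) * √κ ≤ (α + μ) * √κ' := by
    refine abs_le_of_sq_le_sq' ?_ (by positivity) |>.2
    rw [mul_pow, mul_pow, Real.sq_sqrt (by linarith), Real.sq_sqrt (by linarith), hκ, hκ']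
    have e1 : (α + ν) ^ 2 * ((β + ν) / (α + ν)) = (α + ν) * (β + ν) := by field_simp
    have e2 : (α + μ) ^ 2 * ((β + μ) / (α + μ)) = (α + μ) * (β + μ) := by field_simp
    rw [e1, e2]
    nlinarith
  have hfac {a s : ℝ} (ha : 0 < a) (hs : 1 ≤ s) : a⁻¹ * ((s + 1) / s) = a⁻¹ + (a * s)⁻¹ := by
    have : s ≠ 0 := by linarith
    field_simp
  have hρ : (√κ' - 1) / (√κ' + 1) ≤ (√κ - 1) / (√κ + 1) := by
    rw [div_le_div_iff₀ (by linarith) (by linarith)]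
    nlinarith
  rw [cgTerm, cgTerm, ← mul_assoc, ← mul_assoc, hfac hα' hs1, hfac hα (hs1.trans hsle)]
  have hρ0 : 0 ≤ (√κ' - 1) / (√κ' + 1) := div_nonneg (by linarith) (by linarith)
  have hp : 0 < (α + ν) * √κ := mul_pos hα (by linarith)
  gcongr

end Polynomials

/-! ### Euclidean and Frobenius norms -/

theorem norm_toLp_sq {n : ℕ} (v : Fin n → ℝ) : ‖WithLp.toLp 2 v‖ ^ 2 = v ⬝ᵥ v := by
  rw [EuclideanSpace.real_norm_sq_eq]
  simp [dotProduct, sq]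

theorem sum_sq_dotProduct {n : ℕ} {ι : Type*} [Fintype ι]
    (u : OrthonormalBasis ι ℝ (EuclideanSpace ℝ (Fin n))) (v : Fin n → ℝ) :
    ∑ i, ((u i).ofLp ⬝ᵥ v) ^ 2 = v ⬝ᵥ v := by
  rw [← norm_toLp_sq, ← u.sum_sq_inner_left]
  simp [EuclideanSpace.inner_eq_star_dotProduct]

theorem normF_sq {n m : ℕ} (M : Matrix (Fin n) (Fin m) ℝ) :
    normF M ^ 2 = ∑ i, M i ⬝ᵥ M i := by
  rw [normF, frobenius_norm_def, ← Real.sqrt_eq_rpow, Real.sq_sqrt (by positivity)]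
  simp [dotProduct, sq]

theorem normF_nonneg {n m : ℕ} (M : Matrix (Fin n) (Fin m) ℝ) : 0 ≤ normF M := by
  rw [normF, frobenius_norm_def]
  positivity

theorem normF_transpose {n m : ℕ} (M : Matrix (Fin n) (Fin m) ℝ) : normF Mᵀ = normF M :=
  frobenius_norm_transpose M

open scoped Matrix.Norms.Frobenius in
theorem normF_add_le {n m : ℕ} (M N : Matrix (Fin n) (Fin m) ℝ) :
    normF (M + N) ≤ normF M + normF N :=
  norm_add_le M N

theorem mulVec_dotProduct_mulVec {n p : ℕ} {V : Matrix (Fin n) (Fin p) ℝ} (hV : Vᵀ * V = 1)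
    (x y : Fin p → ℝ) : (V *ᵥ x) ⬝ᵥ (V *ᵥ y) = x ⬝ᵥ y := by
  rw [dotProduct_mulVec, ← mulVec_transpose, mulVec_mulVec, hV, one_mulVec]

theorem normF_mul_left {n m p : ℕ} {V : Matrix (Fin n) (Fin p) ℝ} (hV : Vᵀ * V = 1)
    (M : Matrix (Fin p) (Fin m) ℝ) : normF (V * M) = normF M := by
  rw [← sq_eq_sq₀ (normF_nonneg _) (normF_nonneg _), ← normF_transpose, ← normF_transpose M,
    normF_sq, normF_sq]
  exact Finset.sum_congr rfl fun j _ => mulVec_dotProduct_mulVec hV (Mᵀ j) (Mᵀ j)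

/-- The Frobenius norm can be computed in any orthonormal basis. -/
theorem normF_sq_eq_sum_mulVec {n m : ℕ} {ι : Type*} [Fintype ι]
    (u : OrthonormalBasis ι ℝ (EuclideanSpace ℝ (Fin m))) (M : Matrix (Fin n) (Fin m) ℝ) :
    normF M ^ 2 = ∑ j, (M *ᵥ (u j).ofLp) ⬝ᵥ (M *ᵥ (u j).ofLp) := by
  rw [normF_sq]
  simp_rw [← sum_sq_dotProduct u]
  rw [Finset.sum_comm]
  refine Finset.sum_congr rfl fun j _ => ?_
  simp only [dotProduct, mulVec, sq, mul_comm]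

theorem norm2_le_normF {n m : ℕ} (M : Matrix (Fin n) (Fin m) ℝ) : norm2 M ≤ normF M := by
  rw [norm2, l2_opNorm_def]
  refine ContinuousLinearMap.opNorm_le_bound _ (normF_nonneg M) fun x => ?_
  refine abs_le_of_sq_le_sq' ?_ (mul_nonneg (normF_nonneg M) (norm_nonneg x)) |>.2
  change ‖WithLp.toLp 2 (M *ᵥ x.ofLp)‖ ^ 2 ≤ _
  rw [norm_toLp_sq, mul_pow, normF_sq, Finset.sum_mul]
  refine Finset.sum_le_sum fun i _ => ?_
  have h := abs_real_inner_le_norm (WithLp.toLp 2 (M i)) x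
  rw [← norm_toLp_sq, ← mul_pow, ← sq]
  refine sq_le_sq' ?_ ?_
  all_goals
    have e : inner ℝ (WithLp.toLp 2 (M i)) x = (M *ᵥ x.ofLp) i := by
      simp [EuclideanSpace.inner_eq_star_dotProduct, mulVec, dotProduct_comm]
    rw [e] at h
  · exact (abs_le.mp h).1
  · exact (abs_le.mp h).2

/-! ### Symmetric matrices and their quadratic forms -/

/-- The quadratic form of `A` lies between `α ‖x‖²` and `β ‖x‖²`. -/
def HasFormBounds {n : ℕ} (A : Matrix (Fin n) (Fin n) ℝ) (α β : ℝ) : Prop :=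
  ∀ x, α * (x ⬝ᵥ x) ≤ x ⬝ᵥ A *ᵥ x ∧ x ⬝ᵥ A *ᵥ x ≤ β * (x ⬝ᵥ x)

theorem eigenvectorBasis_dotProduct_mulVec {n : ℕ} {A : Matrix (Fin n) (Fin n) ℝ}
    (hA : A.IsHermitian) (i : Fin n) (v : Fin n → ℝ) :
    (hA.eigenvectorBasis i).ofLp ⬝ᵥ A *ᵥ v =
      hA.eigenvalues i * ((hA.eigenvectorBasis i).ofLp ⬝ᵥ v) := by
  have hT : Aᵀ = A := by simpa using hA.eq
  rw [dotProduct_mulVec, ← mulVec_transpose, hT, hA.mulVec_eigenvectorBasis, smul_dotProduct,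
    smul_eq_mul]

/-- Reduces matrix polynomial errors to scalar errors at the eigenvalues. -/
theorem eigenvectorBasis_dotProduct_aeval {n : ℕ} {A : Matrix (Fin n) (Fin n) ℝ}
    (hA : A.IsHermitian) (i : Fin n) (P : Polynomial ℝ) (v : Fin n → ℝ) :
    (hA.eigenvectorBasis i).ofLp ⬝ᵥ Polynomial.aeval A P *ᵥ v =
      P.eval (hA.eigenvalues i) * ((hA.eigenvectorBasis i).ofLp ⬝ᵥ v) := by
  induction P using Polynomial.induction_on' generalizing v with
  | add P Q hP hQ => simp [add_mulVec, dotProduct_add, hP, hQ, add_mul]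
  | monomial j a =>
    rw [Polynomial.aeval_monomial, Polynomial.eval_monomial, ← Algebra.smul_def, smul_mulVec,
      dotProduct_smul, smul_eq_mul, mul_assoc]
    congr 1
    induction j generalizing v with
    | zero => simp
    | succ j ih =>
      rw [pow_succ, ← mulVec_mulVec, ih, eigenvectorBasis_dotProduct_mulVec]
      ring

/-- Test the form on a unit eigenvector. With `compress`, this confines the Ritz values to the same
interval. -/
theorem HasFormBounds.eigenvalues_mem {n : ℕ} {A : Matrix (Fin n) (Fin n) ℝ} {α β : ℝ}
    (h : HasFormBounds A α β) (hA : A.IsHermitian) (i : Fin n) :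
    hA.eigenvalues i ∈ Set.Icc α β := by
  have h1 : (hA.eigenvectorBasis i).ofLp ⬝ᵥ (hA.eigenvectorBasis i).ofLp = 1 := by
    rw [← norm_toLp_sq]
    simp
  have := h (hA.eigenvectorBasis i).ofLp
  rw [eigenvectorBasis_dotProduct_mulVec, h1] at this
  simpa using this

theorem dotProduct_mulVec_eq_sum {n : ℕ} {A : Matrix (Fin n) (Fin n) ℝ} (hA : A.IsHermitian)
    (x : Fin n → ℝ) :
    x ⬝ᵥ A *ᵥ x = ∑ i, hA.eigenvalues i * ((hA.eigenvectorBasis i).ofLp ⬝ᵥ x) ^ 2 := by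
  have h := hA.eigenvectorBasis.sum_inner_mul_inner (WithLp.toLp 2 x) (WithLp.toLp 2 (A *ᵥ x))
  simp only [EuclideanSpace.inner_eq_star_dotProduct, star_trivial] at h
  rw [dotProduct_comm, ← h]
  refine Finset.sum_congr rfl fun i _ => ?_
  rw [dotProduct_comm (A *ᵥ x), eigenvectorBasis_dotProduct_mulVec]
  ring

theorem hasFormBounds_lambda {n : ℕ} {A : Matrix (Fin n) (Fin n) ℝ} (hA : A.IsHermitian) :
    HasFormBounds A (lambdaMin A) (lambdaMax A) := by
  intro x
  have hfin : (spectrum ℝ A).Finite := finite_real_spectrum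
  rw [dotProduct_mulVec_eq_sum hA, ← sum_sq_dotProduct hA.eigenvectorBasis, Finset.mul_sum,
    Finset.mul_sum]
  constructor
  · refine Finset.sum_le_sum fun i _ => mul_le_mul_of_nonneg_right ?_ (sq_nonneg _)
    exact csInf_le hfin.bddBelow (hA.eigenvalues_mem_spectrum_real i)
  · refine Finset.sum_le_sum fun i _ => mul_le_mul_of_nonneg_right ?_ (sq_nonneg _)
    exact le_csSup hfin.bddAbove (hA.eigenvalues_mem_spectrum_real i)

theorem lambdaMin_pos_and_le_lambdaMax {n : ℕ} [NeZero n] {A : Matrix (Fin n) (Fin n) ℝ}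
    (hA : A.PosDef) : 0 < lambdaMin A ∧ lambdaMin A ≤ lambdaMax A := by
  have hfin : (spectrum ℝ A).Finite := finite_real_spectrum
  have hne : (spectrum ℝ A).Nonempty := ⟨_, hA.1.eigenvalues_mem_spectrum_real 0⟩
  refine ⟨?_, csInf_le_csSup hne hfin.bddBelow hfin.bddAbove⟩
  have h : lambdaMin A ∈ spectrum ℝ A := hne.csInf_mem hfin
  rw [hA.1.spectrum_real_eq_range_eigenvalues] at h
  obtain ⟨i, hi⟩ := h
  rw [← hi]
  exact hA.eigenvalues_pos i

/-- Compression by a matrix with orthonormal columns preserves bounds of the quadratic form. -/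
theorem HasFormBounds.compress {n p : ℕ} {A : Matrix (Fin n) (Fin n) ℝ} {α β : ℝ}
    (h : HasFormBounds A α β) {V : Matrix (Fin n) (Fin p) ℝ} (hV : Vᵀ * V = 1) :
    HasFormBounds (Vᵀ * A * V) α β := by
  intro x
  have e : x ⬝ᵥ (Vᵀ * A * V) *ᵥ x = (V *ᵥ x) ⬝ᵥ A *ᵥ (V *ᵥ x) := by
    rw [← mulVec_mulVec, ← mulVec_mulVec, dotProduct_mulVec x, vecMul_transpose]
  rw [e, ← mulVec_dotProduct_mulVec hV]
  exact h _

theorem isHermitian_compress {n p : ℕ} {A : Matrix (Fin n) (Fin n) ℝ} (hA : A.IsHermitian)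
    (V : Matrix (Fin n) (Fin p) ℝ) : (Vᵀ * A * V).IsHermitian := by
  have := isHermitian_conjTranspose_mul_mul V hA
  rwa [conjTranspose_eq_transpose_of_trivial] at this

/-! ### Unique solvability of the Sylvester equation -/

/-- For an eigenvector `u` of `B`, pairing the equation at `u` with `X u` gives `0 ≥ (α + ν) ‖X
u‖²`. -/
theorem eq_zero_of_sylvester_eq_zero {n m : ℕ} {A : Matrix (Fin n) (Fin n) ℝ}
    {B : Matrix (Fin m) (Fin m) ℝ} {α β ν ξ : ℝ} (hA : HasFormBounds A α β)
    (hB : HasFormBounds B ν ξ) (hBs : B.IsHermitian) (hpos : 0 < α + ν)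
    {X : Matrix (Fin n) (Fin m) ℝ} (hX : A * X + X * B = 0) : X = 0 := by
  have h0 : normF X ^ 2 = 0 := by
    rw [normF_sq_eq_sum_mulVec hBs.eigenvectorBasis]
    refine Finset.sum_eq_zero fun j _ => ?_
    set u := (hBs.eigenvectorBasis j).ofLp with hu
    have h := congrArg (fun M => (X *ᵥ u) ⬝ᵥ M *ᵥ u) hX
    simp only [add_mulVec, ← mulVec_mulVec, zero_mulVec, dotProduct_zero, dotProduct_add] at h
    rw [hu, hBs.mulVec_eigenvectorBasis, ← hu, mulVec_smul, dotProduct_smul, smul_eq_mul] at h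
    have h1 := (hA (X *ᵥ u)).1
    have h2 := (hB.eigenvalues_mem hBs j).1
    have h3 : 0 ≤ (X *ᵥ u) ⬝ᵥ (X *ᵥ u) := by rw [← norm_toLp_sq]; positivity
    nlinarith
  rw [normF_sq, Finset.sum_eq_zero_iff_of_nonneg
    fun i _ => by rw [← norm_toLp_sq]; positivity] at h0
  ext i j
  exact congrFun (dotProduct_self_eq_zero.mp (h0 i (Finset.mem_univ i))) j

theorem existsUnique_sylvester {n m : ℕ} {A : Matrix (Fin n) (Fin n) ℝ}
    {B : Matrix (Fin m) (Fin m) ℝ} {α β ν ξ : ℝ} (hA : HasFormBounds A α β)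
    (hB : HasFormBounds B ν ξ) (hBs : B.IsHermitian) (hpos : 0 < α + ν)
    (C : Matrix (Fin n) (Fin m) ℝ) :
    ∃! X : Matrix (Fin n) (Fin m) ℝ, A * X + X * B = C := by
  let L : Matrix (Fin n) (Fin m) ℝ →ₗ[ℝ] Matrix (Fin n) (Fin m) ℝ :=
    { toFun := fun X => A * X + X * B
      map_add' := fun X Y => by rw [Matrix.mul_add, Matrix.add_mul]; abel
      map_smul' := fun c X => by simp [smul_add] }
  have hinj : Function.Injective L :=
    (injective_iff_map_eq_zero L).mpr fun X hX => eq_zero_of_sylvester_eq_zero hA hB hBs hpos hX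
  exact Function.Bijective.existsUnique ⟨hinj, LinearMap.injective_iff_surjective.mp hinj⟩ C

/-! ### Galerkin projection onto Krylov spaces -/

/-- A polynomial approximating `(x + μ)⁻¹` approximates the solution of a shifted system. -/
theorem norm_solution_sub_aeval_le {n : ℕ} {A : Matrix (Fin n) (Fin n) ℝ} {α β μ ε : ℝ}
    (hA : HasFormBounds A α β) (hAs : A.IsHermitian) (hpos : 0 < α + μ) (hε : 0 ≤ ε)
    {P : Polynomial ℝ} (hP : ∀ x ∈ Set.Icc α β, |(x + μ)⁻¹ - P.eval x| ≤ ε)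
    {y b : Fin n → ℝ} (hy : A *ᵥ y + μ • y = b) :
    ‖WithLp.toLp 2 (y - Polynomial.aeval A P *ᵥ b)‖ ≤ ε * ‖WithLp.toLp 2 b‖ := by
  refine abs_le_of_sq_le_sq' ?_ (by positivity) |>.2
  rw [mul_pow, norm_toLp_sq, norm_toLp_sq, ← sum_sq_dotProduct hAs.eigenvectorBasis,
    ← sum_sq_dotProduct hAs.eigenvectorBasis b, Finset.mul_sum]
  refine Finset.sum_le_sum fun i _ => ?_
  have hmem := hA.eigenvalues_mem hAs i
  have h1 := congrArg (fun v => (hAs.eigenvectorBasis i).ofLp ⬝ᵥ v) hy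
  simp only [dotProduct_add, dotProduct_smul, smul_eq_mul,
    eigenvectorBasis_dotProduct_mulVec] at h1
  have hne : 0 < hAs.eigenvalues i + μ := by linarith [hmem.1]
  have h2 : (hAs.eigenvectorBasis i).ofLp ⬝ᵥ y =
      (hAs.eigenvalues i + μ)⁻¹ * ((hAs.eigenvectorBasis i).ofLp ⬝ᵥ b) := by
    rw [← h1]
    field_simp
  rw [dotProduct_sub, eigenvectorBasis_dotProduct_aeval, h2, ← sub_mul, mul_pow]
  refine mul_le_mul_of_nonneg_right ?_ (sq_nonneg _)
  exact sq_le_sq' (abs_le.mp (hP _ hmem)).1 (abs_le.mp (hP _ hmem)).2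

theorem pow_mulVec_mem_krylov {n : ℕ} (A : Matrix (Fin n) (Fin n) ℝ) (b : Fin n → ℝ) {k i : ℕ}
    (hi : i < k) : (A ^ i) *ᵥ b ∈ krylov A b k :=
  Submodule.subset_span ⟨⟨i, hi⟩, rfl⟩

theorem IsOrthonormalBasisMatrix.mulVec_transpose_mulVec {n p : ℕ}
    {V : Matrix (Fin n) (Fin p) ℝ} {K : Submodule ℝ (Fin n → ℝ)}
    (hV : IsOrthonormalBasisMatrix V K) {v : Fin n → ℝ} (hv : v ∈ K) : V *ᵥ Vᵀ *ᵥ v = v := by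
  rw [← hV.2] at hv
  obtain ⟨w, rfl⟩ := hv
  rw [mulVecLin_apply, mulVec_mulVec w Vᵀ V, hV.1, one_mulVec]

/-- The Krylov compression is exact on polynomials of degree less than `k`. -/
theorem mulVec_aeval_compress {n p k : ℕ} {A : Matrix (Fin n) (Fin n) ℝ} {b : Fin n → ℝ}
    {V : Matrix (Fin n) (Fin p) ℝ} (hV : IsOrthonormalBasisMatrix V (krylov A b k))
    {P : Polynomial ℝ} (hP : P.degree < k) :
    V *ᵥ (Polynomial.aeval (Vᵀ * A * V) P *ᵥ (Vᵀ *ᵥ b)) = Polynomial.aeval A P *ᵥ b := by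
  -- For `i < k` each `A^i b` stays in the Krylov space, where `V Vᵀ` is the identity.
  have hpow (i : ℕ) (hi : i < k) : V *ᵥ ((Vᵀ * A * V) ^ i *ᵥ (Vᵀ *ᵥ b)) = A ^ i *ᵥ b := by
    induction i with
    | zero =>
      have := hV.mulVec_transpose_mulVec (pow_mulVec_mem_krylov A b hi)
      simpa using this
    | succ i ih =>
      have h := hV.mulVec_transpose_mulVec (pow_mulVec_mem_krylov A b hi)
      rw [pow_succ', ← mulVec_mulVec] at h
      rw [pow_succ', pow_succ', ← mulVec_mulVec, ← mulVec_mulVec, ← mulVec_mulVec, ← mulVec_mulVec,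
        ih (Nat.lt_of_succ_lt hi), h]
  rcases eq_or_ne P 0 with rfl | hP0
  · simp
  have hdeg : P.natDegree < k := (Polynomial.natDegree_lt_iff_degree_lt hP0).mpr hP
  rw [Polynomial.aeval_eq_sum_range' hdeg, Polynomial.aeval_eq_sum_range' hdeg, sum_mulVec,
    sum_mulVec, mulVec_sum]
  refine Finset.sum_congr rfl fun i hi => ?_
  rw [smul_mulVec, smul_mulVec, mulVec_smul, hpow i (Finset.mem_range.mp hi)]

theorem norm_toLp_mulVec {n p : ℕ} {V : Matrix (Fin n) (Fin p) ℝ} (hV : Vᵀ * V = 1)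
    (x : Fin p → ℝ) : ‖WithLp.toLp 2 (V *ᵥ x)‖ = ‖WithLp.toLp 2 x‖ := by
  rw [← sq_eq_sq₀ (norm_nonneg _) (norm_nonneg _), norm_toLp_sq, norm_toLp_sq,
    mulVec_dotProduct_mulVec hV]

/-- Bessel's inequality: expand `‖x - V Vᵀ x‖² ≥ 0`. -/
theorem norm_toLp_transpose_mulVec_le {n p : ℕ} {V : Matrix (Fin n) (Fin p) ℝ} (hV : Vᵀ * V = 1)
    (x : Fin n → ℝ) : ‖WithLp.toLp 2 (Vᵀ *ᵥ x)‖ ≤ ‖WithLp.toLp 2 x‖ := by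
  refine abs_le_of_sq_le_sq' ?_ (norm_nonneg _) |>.2
  have h : 0 ≤ (x - V *ᵥ Vᵀ *ᵥ x) ⬝ᵥ (x - V *ᵥ Vᵀ *ᵥ x) := by rw [← norm_toLp_sq]; positivity
  have h1 : x ⬝ᵥ V *ᵥ Vᵀ *ᵥ x = (Vᵀ *ᵥ x) ⬝ᵥ (Vᵀ *ᵥ x) := by
    rw [dotProduct_mulVec, ← mulVec_transpose]
  rw [sub_dotProduct, dotProduct_sub, dotProduct_sub, mulVec_dotProduct_mulVec hV,
    dotProduct_comm (V *ᵥ _) x, h1] at h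
  rw [norm_toLp_sq, norm_toLp_sq]
  linarith

/-- Error of the Galerkin approximation of a shifted linear system from a Krylov space. -/
theorem norm_galerkin_error_le {n p k : ℕ} {A : Matrix (Fin n) (Fin n) ℝ} {α β μ : ℝ}
    (hA : HasFormBounds A α β) (hAs : A.IsHermitian) (hpos : 0 < α + μ) (hαβ : α ≤ β)
    {b : Fin n → ℝ} {V : Matrix (Fin n) (Fin p) ℝ}
    (hV : IsOrthonormalBasisMatrix V (krylov A b k)) (c : ℝ)
    {y : Fin n → ℝ} (hy : A *ᵥ y + μ • y = c • b)
    {z : Fin p → ℝ} (hz : (Vᵀ * A * V) *ᵥ z + μ • z = c • (Vᵀ *ᵥ b)) :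
    ‖WithLp.toLp 2 (y - V *ᵥ z)‖ ≤
      2 * ((α + μ)⁻¹ * cgTerm ((β + μ) / (α + μ)) k) * (|c| * ‖WithLp.toLp 2 b‖) := by
  obtain ⟨P, hPdeg, hP⟩ := exists_polynomial_approx_inv hpos hαβ k
  set ε := (α + μ)⁻¹ * cgTerm ((β + μ) / (α + μ)) k
  have hε : 0 ≤ ε := (abs_nonneg _).trans (hP α ⟨le_rfl, hαβ⟩)
  have h1 := norm_solution_sub_aeval_le hA hAs hpos hε hP hy
  -- The same `P` serves the compressed system, and both solutions are compared with `c • P(A) b`;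
  -- hence the factor `2`.
  have h2 := norm_solution_sub_aeval_le (hA.compress hV.1) (isHermitian_compress hAs V) hpos hε
    hP hz
  rw [← norm_toLp_mulVec hV.1, mulVec_sub, mulVec_smul, mulVec_smul,
    mulVec_aeval_compress hV hPdeg] at h2
  rw [mulVec_smul] at h1
  have hsplit : WithLp.toLp 2 (y - V *ᵥ z) =
      WithLp.toLp 2 (y - c • Polynomial.aeval A P *ᵥ b) -
        WithLp.toLp 2 (V *ᵥ z - c • Polynomial.aeval A P *ᵥ b) := by
    rw [← WithLp.toLp_sub]
    congr 1
    abel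
  have h3 := norm_toLp_transpose_mulVec_le hV.1 b
  rw [WithLp.toLp_smul, norm_smul, Real.norm_eq_abs] at h1 h2
  have h4 : ε * (|c| * ‖WithLp.toLp 2 (Vᵀ *ᵥ b)‖) ≤ ε * (|c| * ‖WithLp.toLp 2 b‖) := by gcongr
  rw [hsplit]
  linarith [norm_sub_le (WithLp.toLp 2 (y - c • Polynomial.aeval A P *ᵥ b))
    (WithLp.toLp 2 (V *ᵥ z - c • Polynomial.aeval A P *ᵥ b))]

/-- Error caused by projecting the Sylvester equation on one side onto a Krylov space. -/
theorem normF_oneSided_error_le {n m p k : ℕ} {A : Matrix (Fin n) (Fin n) ℝ}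
    {B : Matrix (Fin m) (Fin m) ℝ} {α β ν ξ : ℝ}
    (hA : HasFormBounds A α β) (hAs : A.IsHermitian) (hαβ : α ≤ β)
    (hB : HasFormBounds B ν ξ) (hBs : B.IsHermitian) (hpos : 0 < α + ν)
    {b : Fin n → ℝ} (hb : ‖WithLp.toLp 2 b‖ ≤ 1) {d : Fin m → ℝ} (hd : ‖WithLp.toLp 2 d‖ ≤ 1)
    {V : Matrix (Fin n) (Fin p) ℝ} (hV : IsOrthonormalBasisMatrix V (krylov A b k))
    {X : Matrix (Fin n) (Fin m) ℝ} (hX : A * X + X * B = vecMulVec b d)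
    {Z : Matrix (Fin p) (Fin m) ℝ} (hZ : Vᵀ * A * V * Z + Z * B = vecMulVec (Vᵀ *ᵥ b) d) :
    normF (X - V * Z) ≤ 2 * ((α + ν)⁻¹ * cgTerm ((β + ν) / (α + ν)) k) := by
  set ε := (α + ν)⁻¹ * cgTerm ((β + ν) / (α + ν)) k with hεdef
  have hε : 0 ≤ ε := by
    obtain ⟨P, -, hP⟩ := exists_polynomial_approx_inv hpos hαβ k
    exact (abs_nonneg _).trans (hP α ⟨le_rfl, hαβ⟩)
  refine abs_le_of_sq_le_sq' ?_ (by positivity) |>.2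
  have hcol (j : Fin m) : ((X - V * Z) *ᵥ (hBs.eigenvectorBasis j).ofLp) ⬝ᵥ
      ((X - V * Z) *ᵥ (hBs.eigenvectorBasis j).ofLp) ≤
        (2 * ε) ^ 2 * ((hBs.eigenvectorBasis j).ofLp ⬝ᵥ d) ^ 2 := by
    set u := (hBs.eigenvectorBasis j).ofLp with hu
    set μ := hBs.eigenvalues j
    have hBu : B *ᵥ u = μ • u := hBs.mulVec_eigenvectorBasis j
    have hνμ : ν ≤ μ := (hB.eigenvalues_mem hBs j).1
    have hy : A *ᵥ (X *ᵥ u) + μ • (X *ᵥ u) = (u ⬝ᵥ d) • b := by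
      have := congrArg (· *ᵥ u) hX
      simpa only [add_mulVec, ← mulVec_mulVec, hBu, mulVec_smul, vecMulVec_mulVec, dotProduct_comm,
        op_smul_eq_smul] using this
    have hz : (Vᵀ * A * V) *ᵥ (Z *ᵥ u) + μ • (Z *ᵥ u) = (u ⬝ᵥ d) • (Vᵀ *ᵥ b) := by
      have := congrArg (· *ᵥ u) hZ
      simp only [add_mulVec, vecMulVec_mulVec, op_smul_eq_smul] at this
      rwa [← mulVec_mulVec, ← mulVec_mulVec u Z B, hBu, mulVec_smul, dotProduct_comm] at this
    have h := norm_galerkin_error_le hA hAs (by linarith) hαβ hV _ hy hz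
    rw [sub_mulVec, ← mulVec_mulVec, ← norm_toLp_sq, ← sq_abs (u ⬝ᵥ d), ← mul_pow]
    gcongr
    refine h.trans ?_
    -- Replaces the shift `μ` by `ν`, making the bound uniform over the eigenvectors.
    have hmono := inv_mul_cgTerm_antitone hpos hαβ hνμ k
    have hc : |u ⬝ᵥ d| * ‖WithLp.toLp 2 b‖ ≤ |u ⬝ᵥ d| :=
      mul_le_of_le_one_right (abs_nonneg _) hb
    gcongr
  rw [normF_sq_eq_sum_mulVec hBs.eigenvectorBasis]
  refine (Finset.sum_le_sum fun j _ => hcol j).trans ?_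
  rw [← Finset.mul_sum, sum_sq_dotProduct, ← norm_toLp_sq]
  exact mul_le_of_le_one_right (sq_nonneg _) (pow_le_one₀ (norm_nonneg _) hd)

/-- The Galerkin condition is the compressed Sylvester equation. -/
theorem isGalerkin_iff {n m p q : ℕ} {A : Matrix (Fin n) (Fin n) ℝ}
    {B : Matrix (Fin m) (Fin m) ℝ} {b₁ : Fin n → ℝ} {b₂ : Fin m → ℝ}
    {V : Matrix (Fin n) (Fin p) ℝ} {W : Matrix (Fin m) (Fin q) ℝ} (hV : Vᵀ * V = 1)
    (hW : Wᵀ * W = 1) (Y : Matrix (Fin p) (Fin q) ℝ) :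
    IsGalerkin A B b₁ b₂ V W Y ↔
      Vᵀ * A * V * Y + Y * (Wᵀ * B * W) = vecMulVec (Vᵀ *ᵥ b₁) (Wᵀ *ᵥ b₂) := by
  have e1 : Vᵀ * (A * (V * Y * Wᵀ)) * W = Vᵀ * A * V * Y := by
    calc _ = Vᵀ * A * V * Y * (Wᵀ * W) := by simp only [Matrix.mul_assoc]
      _ = _ := by rw [hW, Matrix.mul_one]
  have e2 : Vᵀ * (V * Y * Wᵀ * B) * W = Y * (Wᵀ * B * W) := by
    calc _ = Vᵀ * V * (Y * (Wᵀ * B * W)) := by simp only [Matrix.mul_assoc]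
      _ = _ := by rw [hV, Matrix.one_mul]
  have e3 : Vᵀ * vecMulVec b₁ b₂ * W = vecMulVec (Vᵀ *ᵥ b₁) (Wᵀ *ᵥ b₂) := by
    rw [mul_vecMulVec, vecMulVec_mul, mulVec_transpose W]
  rw [IsGalerkin, residual, Matrix.mul_sub, Matrix.mul_add, Matrix.sub_mul, Matrix.add_mul, e1, e2,
    e3, sub_eq_zero]

end SylvesterGalerkin

/-! ### Two-sided projection as two one-sided projections -/

theorem proposition3p2 {n m p q : ℕ} (k : ℕ)
    (A : Matrix (Fin n) (Fin n) ℝ) (B : Matrix (Fin m) (Fin m) ℝ)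
    (hA : A.PosDef) (hB : B.PosDef)
    (b₁ : Fin n → ℝ) (b₂ : Fin m → ℝ)
    (hb₁ : ‖WithLp.toLp 2 b₁‖ = 1) (hb₂ : ‖WithLp.toLp 2 b₂‖ = 1)
    (V : Matrix (Fin n) (Fin p) ℝ) (W : Matrix (Fin m) (Fin q) ℝ)
    (hV : SylvesterGalerkin.IsOrthonormalBasisMatrix V (SylvesterGalerkin.krylov A b₁ k))
    (hW : SylvesterGalerkin.IsOrthonormalBasisMatrix W (SylvesterGalerkin.krylov B b₂ k)) :
    (∃! X : Matrix (Fin n) (Fin m) ℝ, SylvesterGalerkin.IsSolution A B b₁ b₂ X) ∧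
    (∃! Y : Matrix (Fin p) (Fin q) ℝ, SylvesterGalerkin.IsGalerkin A B b₁ b₂ V W Y) ∧
    ∀ (X : Matrix (Fin n) (Fin m) ℝ) (Y : Matrix (Fin p) (Fin q) ℝ),
      SylvesterGalerkin.IsSolution A B b₁ b₂ X →
      SylvesterGalerkin.IsGalerkin A B b₁ b₂ V W Y →
      SylvesterGalerkin.norm2 (X - V * Y * Wᵀ) ≤ SylvesterGalerkin.errorBound A B k ∧
      SylvesterGalerkin.normF (X - V * Y * Wᵀ) ≤ SylvesterGalerkin.errorBound A B k := by
  -- A unit vector excludes dimension zero, where the spectrum is empty and `lambdaMin` would be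
  -- `sInf ∅ = 0`.
  have : NeZero n := ⟨by
    rintro rfl
    rw [Subsingleton.elim (WithLp.toLp 2 b₁) 0, norm_zero] at hb₁
    exact zero_ne_one hb₁⟩
  have : NeZero m := ⟨by
    rintro rfl
    rw [Subsingleton.elim (WithLp.toLp 2 b₂) 0, norm_zero] at hb₂
    exact zero_ne_one hb₂⟩
  obtain ⟨hα, hαβ⟩ := SylvesterGalerkin.lambdaMin_pos_and_le_lambdaMax hA
  obtain ⟨hν, hνξ⟩ := SylvesterGalerkin.lambdaMin_pos_and_le_lambdaMax hB
  have hAf := SylvesterGalerkin.hasFormBounds_lambda hA.1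
  have hBf := SylvesterGalerkin.hasFormBounds_lambda hB.1
  have hTf := hAf.compress hV.1
  have hSf := hBf.compress hW.1
  have hTs := SylvesterGalerkin.isHermitian_compress hA.1 V
  have hSs := SylvesterGalerkin.isHermitian_compress hB.1 W
  have hpos := add_pos hα hν
  refine ⟨SylvesterGalerkin.existsUnique_sylvester hAf hBf hB.1 hpos _, ?_, ?_⟩
  · simp only [SylvesterGalerkin.isGalerkin_iff hV.1 hW.1]
    exact SylvesterGalerkin.existsUnique_sylvester hTf hSf hSs hpos _
  intro X Y hX hY
  rw [SylvesterGalerkin.isGalerkin_iff hV.1 hW.1] at hY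
  suffices h : SylvesterGalerkin.normF (X - V * Y * Wᵀ) ≤ SylvesterGalerkin.errorBound A B k from
    ⟨(SylvesterGalerkin.norm2_le_normF _).trans h, h⟩
  obtain ⟨Z, hZ, -⟩ := SylvesterGalerkin.existsUnique_sylvester hTf hBf hB.1 hpos
    (vecMulVec (Vᵀ *ᵥ b₁) b₂)
  have h1 := SylvesterGalerkin.normF_oneSided_error_le hAf hA.1 hαβ hBf hB.1 hpos hb₁.le hb₂.le
    hV hX hZ
  have hTt : (Vᵀ * A * V)ᵀ = Vᵀ * A * V := by simpa using hTs.eq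
  have hBt : Bᵀ = B := by simpa using hB.1.eq
  have hSt : (Wᵀ * B * W)ᵀ = Wᵀ * B * W := by simpa using hSs.eq
  have hZt : B * Zᵀ + Zᵀ * (Vᵀ * A * V) = vecMulVec b₂ (Vᵀ *ᵥ b₁) := by
    have := congrArg transpose hZ
    rwa [transpose_add, transpose_mul _ Z, transpose_mul Z, hTt, hBt, transpose_vecMulVec,
      add_comm] at this
  have hYt : Wᵀ * B * W * Yᵀ + Yᵀ * (Vᵀ * A * V) = vecMulVec (Wᵀ *ᵥ b₂) (Vᵀ *ᵥ b₁) := by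
    have := congrArg transpose hY
    rwa [transpose_add, transpose_mul _ Y, transpose_mul Y, hTt, hSt, transpose_vecMulVec,
      add_comm] at this
  -- The second vector is now `Vᵀ b₁`, only known to have norm at most `1`.
  have h2 := SylvesterGalerkin.normF_oneSided_error_le hBf hB.1 hνξ hTf hTs (add_pos hν hα) hb₂.le
    ((SylvesterGalerkin.norm_toLp_transpose_mulVec_le hV.1 b₁).trans hb₁.le) hW hZt hYt
  have h3 : SylvesterGalerkin.normF (V * (Z - Y * Wᵀ)) =
      SylvesterGalerkin.normF (Zᵀ - W * Yᵀ) := by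
    rw [SylvesterGalerkin.normF_mul_left hV.1, ← SylvesterGalerkin.normF_transpose, transpose_sub,
      transpose_mul, transpose_transpose]
  have hsplit : X - V * Y * Wᵀ = (X - V * Z) + V * (Z - Y * Wᵀ) := by
    rw [Matrix.mul_sub, Matrix.mul_assoc]
    abel
  rw [hsplit]
  refine (SylvesterGalerkin.normF_add_le _ _).trans ?_
  rw [h3]
  refine (add_le_add h1 h2).trans_eq ?_
  rw [SylvesterGalerkin.errorBound, SylvesterGalerkin.kappaHat, SylvesterGalerkin.kappaHat,
    add_comm (SylvesterGalerkin.lambdaMin B) (SylvesterGalerkin.lambdaMin A)]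
  ring
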